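/- Let $G=(V,E)$ be a finite simple graph with Laplacian $L=D-A$ (degree matrix minus adjacency matrix), let $\Psi\le\mathrm{Aut}(G)$ be a group of automorphisms, and let $\mathcal O_1,\dots,\mathcal O_s$ be the orbits of $\Psi$ on $E$. For $\varphi:V\to\mathbb R$ put $$\ell_\Psi(\varphi)=\Big(\sum_{uv\in\mathcal O_i}(\varphi(u)-\varphi(v))^2\Big)_{i=1}^s\in\mathbb R^s .$$ Let $\lambda>0$ be an eigenvalue of $L$ and $\mathcal E_\lambda\subseteq\mathbb R^V$ its eigenspace, a real representation of $\Psi$ through $(\sigma\cdot\varphi)(u)=\varphi(\sigma^{-1}(u))$. An orbit-isometric embedding of $G$ on $\mathcal E_\lambda$ is a map $p:V\to\mathbb R^r$, $v\mapsto p_v$ (for some $r$), such that each coordinate function $v\mapsto (p_v)_j$ is an eigenvector of $L$ with eigenvalue $\lambda$ and, for some $c>0$, $$\frac1{|\mathcal O_i|}\sum_{uv\in\mathcal O_i}\|p_u-p_v\|^2=c\qquad\text{for all } 1\le i\le s .$$ **Theorem.** Let $\mathcal E_\lambda=X_1\oplus\cdots\oplus X_h$ be the isotypic decomposition of $\mathcal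 E_\lambda$ as a $\Psi$-representation, with $X_i\cong\mathbb R^{m_i}\otimes U_i$, where $\Psi$ acts trivially on $\mathbb R^{m_i}$ and $U_1,\dots,U_h$ are pairwise non-isomorphic irreducible real representations of $\Psi$. Let $D_i=\mathrm{End}_\Psi(U_i)$, a real division algebra over which $U_i$ is a left vector space. If $m_i\le\dim_{D_i}U_i$ for all $1\le i\le h$, then 1. $\ell_\Psi(\mathcal E_\lambda)=\{\ell_\Psi(\varphi):\varphi\in\mathcal E_\lambda\}$ is a convex cone (containing the origin), and 2. $G$ has an orbit-isometric embedding on $\mathcal E_\lambda$ if and only if there is a single $\varphi\in\mathcal E_\lambda$ with $\ell_\Psi(\varphi)=(|\mathcal O_1|,\dots,|\mathcal O_s|)$. -/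

import Mathlib

open scoped MonoidAlgebra

noncomputable section

namespace OrbitEnergy

variable {V : Type*} (G : SimpleGraph V) (Ψ : Subgroup (G ≃g G))

/-- A group of automorphisms acts on the edge set by `σ • uv = σ(u)σ(v)`. -/
instance edgeAction : MulAction Ψ G.edgeSet where
  smul σ e := (σ : G ≃g G).mapEdgeSet e
  one_smul e := Subtype.ext (congrFun Sym2.map_id (e : Sym2 V))
  mul_smul σ τ e := by
    obtain ⟨e, he⟩ := e
    induction e
    rfl

/-- The index set of the edge orbits of `G` under `Ψ`. -/
abbrev EdgeOrbit : Type _ := MulAction.orbitRel.Quotient Ψ G.edgeSet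

/-- The edge orbit with index `i`, as a finite set of edges. -/
def orbitEdges [Finite V] (i : EdgeOrbit G Ψ) : Finset G.edgeSet :=
  (Set.toFinite {e : G.edgeSet | (Quotient.mk _ e : EdgeOrbit G Ψ) = i}).toFinset

/-- `(f u - f v) ^ 2`, for a real function `f` on the vertices and an unordered pair `uv`. -/
def edgeEnergy (f : V → ℝ) : Sym2 V → ℝ :=
  Sym2.lift ⟨fun u v => (f u - f v) ^ 2, fun u v => by ring⟩

/-- `‖p u - p v‖ ^ 2`, for a map `p` of the vertices to `ℝ ^ r` and an unordered pair `uv`. -/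
def edgeSqLength {r : ℕ} (p : V → EuclideanSpace ℝ (Fin r)) : Sym2 V → ℝ :=
  Sym2.lift ⟨fun u v => ‖p u - p v‖ ^ 2, fun u v => by simp only [norm_sub_rev]⟩

/-- The orbit-energy vector `ℓ_Ψ(f)`. -/
def orbitEnergy [Finite V] (f : V → ℝ) : EdgeOrbit G Ψ → ℝ :=
  fun i => ∑ e ∈ orbitEdges G Ψ i, edgeEnergy f e

/-- The vector of the sizes of the edge orbits. -/
def orbitSizes [Finite V] : EdgeOrbit G Ψ → ℝ :=
  fun i => ((orbitEdges G Ψ i).card : ℝ)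

/-- The average squared edge length of `p` is the same positive number on every edge orbit. -/
def IsOrbitIsometric [Finite V] {r : ℕ} (p : V → EuclideanSpace ℝ (Fin r)) : Prop :=
  ∃ c : ℝ, 0 < c ∧ ∀ i : EdgeOrbit G Ψ,
    (1 / ((orbitEdges G Ψ i).card : ℝ)) * ∑ e ∈ orbitEdges G Ψ i, edgeSqLength p e = c

/-- The permutation representation of `Ψ` on `ℝ ^ V`: `(σ · f)(u) = f(σ⁻¹ u)`. -/
def permRep : Representation ℝ Ψ (V → ℝ) where
  toFun σ := LinearMap.funLeft ℝ ℝ ((σ⁻¹ : Ψ) : G ≃g G)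
  map_one' := by ext; simp [LinearMap.funLeft]
  map_mul' σ τ := by
    apply LinearMap.ext; intro f; funext u
    simp only [LinearMap.funLeft_apply, Module.End.mul_apply, mul_inv_rev]
    rfl

variable [Fintype V] [DecidableEq V] [DecidableRel G.Adj]

/-- The graph Laplacian as a linear operator on `ℝ ^ V`. -/
def laplacian : Module.End ℝ (V → ℝ) := Matrix.toLin' (G.lapMatrix ℝ)

theorem laplacian_apply (f : V → ℝ) (u : V) :
    laplacian G f u = ∑ w, if G.Adj u w then f u - f w else 0 := by
  simp only [laplacian, Matrix.toLin'_apply, SimpleGraph.lapMatrix_mulVec_apply]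
  rw [← Finset.sum_filter, ← SimpleGraph.neighborFinset_eq_filter, Finset.sum_sub_distrib,
    Finset.sum_const, nsmul_eq_mul, SimpleGraph.card_neighborFinset_eq_degree]

theorem laplacian_permRep (σ : Ψ) (f : V → ℝ) :
    laplacian G (permRep G Ψ σ f) = permRep G Ψ σ (laplacian G f) := by
  funext u
  have h (g : V → ℝ) (w : V) : permRep G Ψ σ g w = g (((σ⁻¹ : Ψ) : G ≃g G) w) := rfl
  rw [h, laplacian_apply, laplacian_apply]
  refine Fintype.sum_equiv (((σ⁻¹ : Ψ) : G ≃g G).toEquiv) _ _ fun w => ?_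
  simp only [h, RelIso.coe_fn_toEquiv, SimpleGraph.Iso.map_adj_iff]

/-- The Laplacian eigenspace of `lam`, as a subrepresentation of `ℝ ^ V`. -/
def eigenSubrep (lam : ℝ) : Subrepresentation (permRep G Ψ) where
  toSubmodule := (laplacian G).eigenspace lam
  apply_mem_toSubmodule σ f hf := by
    rw [Module.End.mem_eigenspace_iff] at hf ⊢
    rw [laplacian_permRep, hf, map_smul]

/-- The Laplacian eigenspace of `lam`, as a representation of `Ψ`. -/
abbrev eigenRep (lam : ℝ) : Representation ℝ Ψ ((laplacian G).eigenspace lam) :=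
  (eigenSubrep G Ψ lam).toRepresentation

/-- `p : V → ℝ ^ r` is a spectral embedding of `G` on the eigenspace of `lam`: the columns of the
matrix with rows `p v` are Laplacian eigenvectors with eigenvalue `lam`. -/
def IsSpectralEmbedding (lam : ℝ) {r : ℕ} (p : V → EuclideanSpace ℝ (Fin r)) : Prop :=
  ∀ j : Fin r, (laplacian G).HasEigenvector lam fun v => p v j

/-- `G` has an orbit-isometric spectral embedding on the eigenspace of `lam`. -/
def HasOrbitIsometricEmbedding (lam : ℝ) : Prop :=
  ∃ (r : ℕ) (p : V → EuclideanSpace ℝ (Fin r)),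
    IsSpectralEmbedding G lam p ∧ IsOrbitIsometric G Ψ p

/-- The dimension of a real representation `U` of `Γ` over `D = End_Γ(U)` (the `ℝ[Γ]`-linear
endomorphisms of `U`), a division algebra if `U` is irreducible. -/
def endDim {Γ U : Type*} [Group Γ] [AddCommGroup U] [Module ℝ U] (ρ : Representation ℝ Γ U) : ℕ :=
  Module.finrank (Module.End ℝ[Γ] ρ.asModule) ρ.asModule

end OrbitEnergy

end

/-! Write `E` for the eigenspace and `M(φ) = ∑ g, (gφ)(gφ)ᵀ` for the Gram matrix of an orbit. Since
`ℓ_Ψ(φ)` is a linear function of `M(φ)`, convexity follows once the matrices `M(φ)`, `φ ∈ E`, are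
closed under addition. The multiplicity bound gives a separating `v ∈ E`, one killed by no nonzero
endomorphism: in `ℝ^m ⊗ U` take `∑ e_l ⊗ u_l` with the `u_l` independent over `D`
(`exists_separating_vector_of_isotypic`). Then `F = M(v)` is invertible on `E`, and any invariant
positive semidefinite `S` with range in `E` equals `T F Tᵀ = M(Tv)` for the equivariant `T = S^{1/2}
F^{-1/2}` (`exists_orbitGram_eq`). Apply this to `S = M(φ) + M(ψ)`. For embeddings, the energies of
the coordinates add up to `c` times the orbit sizes, and the cone contains this sum. -/

open scoped MonoidAlgebra

noncomputable section

/-! ### Separating vectors of a representation. -/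

namespace Representation

variable {k Γ : Type*} [Field k] [Group Γ]

/-- Linear independence over the endomorphism algebra, tested by intertwining maps. -/
theorem IntertwiningMap.eq_zero_of_sum_eq_zero {U : Type*} [AddCommGroup U] [Module k U]
    {ρ : Representation k Γ U} {n : ℕ} {u : Fin n → ρ.asModule}
    (hu : LinearIndependent (Module.End k[Γ] ρ.asModule) u)
    (f : Fin n → IntertwiningMap ρ ρ)
    (hf : ∑ l, f l (ρ.asModuleEquiv (u l)) = 0) (l : Fin n) : f l = 0 := by
  have h := Fintype.linearIndependent_iff.1 hu
    (fun l => IntertwiningMap.equivLinearMapAsModule ρ ρ (f l)) hf l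
  exact (LinearEquiv.map_eq_zero_iff _).1 h

/-- If a representation is spanned by at most `dim_{D_i} U_i` images of each of the pairwise
non-isomorphic irreducible representations `U_i`, then some vector is killed by no nonzero
intertwining map to any `U_j`. -/
theorem exists_separating_vector {ι W : Type*} [Fintype ι] [DecidableEq ι]
    [AddCommGroup W] [Module k W] {τ : Representation k Γ W}
    {U : ι → Type*} [∀ i, AddCommGroup (U i)] [∀ i, Module k (U i)]
    (ρ : ∀ i, Representation k Γ (U i)) (hirr : ∀ i, (ρ i).IsIrreducible)
    (hdist : ∀ i j, i ≠ j → IsEmpty ((ρ i).Equiv (ρ j))) (m : ι → ℕ)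
    (hm : ∀ i, m i ≤ Module.finrank (Module.End k[Γ] (ρ i).asModule) (ρ i).asModule)
    (a : ∀ i, Fin (m i) → IntertwiningMap (ρ i) τ)
    (ha : ⨆ i, ⨆ l, LinearMap.range (a i l).toLinearMap = ⊤) :
    ∃ v : W, ∀ (j : ι) (f : IntertwiningMap τ (ρ j)), f v = 0 → f = 0 := by
  have hu (i : ι) := exists_linearIndependent_of_le_finrank (hm i)
  choose u hu using hu
  refine ⟨∑ i, ∑ l, a i l ((ρ i).asModuleEquiv (u i l)), fun j f hf => ?_⟩
  -- Schur's lemma for non-isomorphic irreducibles.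
  have hne (i : ι) (hij : i ≠ j) (l : Fin (m i)) : f.comp (a i l) = 0 := by
    have := hirr i
    have := hirr j
    have := hdist i j hij
    exact Subsingleton.elim _ _
  -- Only the terms with `i = j` survive in `f v = 0`, which becomes a `D_j`-linear relation among
  -- the independent `u j l`.
  have heq : ∀ l, f.comp (a j l) = 0 := by
    refine IntertwiningMap.eq_zero_of_sum_eq_zero (hu j) _ ?_
    rw [map_sum, Finset.sum_eq_single j] at hf
    · simpa only [map_sum] using! hf
    · intro i _ hij
      rw [map_sum]
      exact Finset.sum_eq_zero fun l _ => DFunLike.congr_fun (hne i hij l) _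
    · simp
  have hall (i : ι) (l : Fin (m i)) : f.comp (a i l) = 0 := by
    by_cases hij : i = j
    · subst hij; exact heq l
    · exact hne i hij l
  apply IntertwiningMap.ext
  have htop : (⊤ : Submodule k W) ≤ LinearMap.ker f.toLinearMap := by
    rw [← ha]
    refine iSup_le fun i => iSup_le fun l => ?_
    rintro _ ⟨x, rfl⟩
    exact DFunLike.congr_fun (hall i l) x
  exact LinearMap.ext fun x => htop (Submodule.mem_top (x := x))

section Multiplicity

variable {U : Type*} [AddCommGroup U] [Module k U] (ρ : Representation k Γ U) (n : ℕ)

/-- The inclusion of the `l`-th summand in `k ^ n ⊗ U`. -/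
def tensorIncl (l : Fin n) : IntertwiningMap ρ ((trivial k Γ (Fin n → k)).tprod ρ) where
  toLinearMap := TensorProduct.mk k _ _ (Pi.single l 1)
  isIntertwining' g := by ext x; simp

/-- The projection of `k ^ n ⊗ U` to the `l`-th summand. -/
def tensorProj (l : Fin n) : IntertwiningMap ((trivial k Γ (Fin n → k)).tprod ρ) ρ where
  toLinearMap := (_root_.TensorProduct.lid k U).toLinearMap ∘ₗ LinearMap.rTensor U (LinearMap.proj l)
  isIntertwining' g := by ext x; simp

theorem sum_tensorIncl_tensorProj (x : TensorProduct k (Fin n → k) U) :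
    ∑ l, tensorIncl ρ n l (tensorProj ρ n l x) = x := by
  induction x with
  | zero => simp
  | add x y hx hy => simp only [map_add, Finset.sum_add_distrib, hx, hy]
  | tmul c y =>
    have h (l : Fin n) : tensorIncl ρ n l (tensorProj ρ n l (c ⊗ₜ[k] y)) =
        (Pi.single l (c l) : Fin n → k) ⊗ₜ[k] y := by
      change (Pi.single l 1 : Fin n → k) ⊗ₜ[k] (c l • y) = _
      rw [← TensorProduct.smul_tmul, ← Pi.single_smul', smul_eq_mul, mul_one]
    simp only [h]
    rw [← TensorProduct.sum_tmul, Finset.univ_sum_single]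

end Multiplicity

section Internal

variable {ι W : Type*} [DecidableEq ι] [AddCommGroup W] [Module k W] {τ : Representation k Γ W}
  (X : ι → Subrepresentation τ) (hX : DirectSum.IsInternal fun i => (X i).toSubmodule)

/-- The inclusion of a subrepresentation. -/
def subrepIncl (Y : Subrepresentation τ) : IntertwiningMap Y.toRepresentation τ where
  toLinearMap := Y.toSubmodule.subtype
  isIntertwining' _ := rfl

/-- The projection to a summand of an internal direct sum of subrepresentations. -/
def internalProj (j : ι) : IntertwiningMap τ (X j).toRepresentation where
  toLinearMap := DirectSum.component k ι (fun i => (X i).toSubmodule) j ∘ₗ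
    (LinearEquiv.ofBijective (DirectSum.coeLinearMap fun i => (X i).toSubmodule) hX).symm.toLinearMap
  isIntertwining' g := by
    set e := LinearEquiv.ofBijective (DirectSum.coeLinearMap fun i => (X i).toSubmodule) hX
    have key : ∀ (i : ι) (x : (X i).toSubmodule), e.symm (x : W) =
        DirectSum.lof k ι (fun i => (X i).toSubmodule) i x := by
      intro i x
      rw [LinearEquiv.symm_apply_eq]
      exact (DirectSum.coeLinearMap_lof (R := k) (fun i => (X i).toSubmodule) i x).symm
    let c := DirectSum.component k ι (fun i => (X i).toSubmodule) j
    -- After composing with the surjection `e`, equivariance need only be checked on each summand.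
    have h : (c ∘ₗ e.symm.toLinearMap ∘ₗ τ g) ∘ₗ e.toLinearMap =
        ((X j).toRepresentation g ∘ₗ c ∘ₗ e.symm.toLinearMap) ∘ₗ e.toLinearMap := by
      refine DirectSum.linearMap_ext k fun i => LinearMap.ext fun x => ?_
      have he : e (DirectSum.lof k ι (fun i => (X i).toSubmodule) i x) = x :=
        DirectSum.coeLinearMap_lof (R := k) (fun i => (X i).toSubmodule) i x
      have h2 := key i ((X i).toRepresentation g x)
      have h3 : (((X i).toRepresentation g x : (X i).toSubmodule) : W) = τ g x := rfl
      rw [h3] at h2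
      simp only [c, LinearMap.comp_apply, LinearEquiv.coe_coe, he, h2, key]
      by_cases hij : i = j
      · subst hij
        simp only [DirectSum.component.lof_self]
      · simp only [DirectSum.component.of, hij, dif_neg, not_false_iff, map_zero]
    refine LinearMap.ext fun x => ?_
    obtain ⟨y, rfl⟩ := e.surjective x
    exact LinearMap.congr_fun h y

theorem eq_zero_of_internalProj_eq_zero {x : W} (hx : ∀ j, internalProj X hX j x = 0) : x = 0 := by
  set e := LinearEquiv.ofBijective (DirectSum.coeLinearMap fun i => (X i).toSubmodule) hX
  rw [← LinearEquiv.map_eq_zero_iff e.symm]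
  exact DFinsupp.ext hx

end Internal

/-- A representation whose isotypic multiplicities are at most `dim_{D_i} U_i` has a vector that
is killed by no nonzero endomorphism. -/
theorem exists_separating_vector_of_isotypic {ι W : Type*} [Fintype ι] [DecidableEq ι]
    [AddCommGroup W] [Module k W] {τ : Representation k Γ W} (X : ι → Subrepresentation τ)
    (hX : DirectSum.IsInternal fun i => (X i).toSubmodule)
    {U : ι → Type*} [∀ i, AddCommGroup (U i)] [∀ i, Module k (U i)]
    (ρ : ∀ i, Representation k Γ (U i)) (hirr : ∀ i, (ρ i).IsIrreducible)
    (hdist : ∀ i j, i ≠ j → IsEmpty ((ρ i).Equiv (ρ j))) (m : ι → ℕ)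
    (hiso : ∀ i, Nonempty ((X i).toRepresentation.Equiv
      ((trivial k Γ (Fin (m i) → k)).tprod (ρ i))))
    (hm : ∀ i, m i ≤ Module.finrank (Module.End k[Γ] (ρ i).asModule) (ρ i).asModule) :
    ∃ v : W, ∀ f : IntertwiningMap τ τ, f v = 0 → f = 0 := by
  have φ (i : ι) := (hiso i).some
  obtain ⟨v, hv⟩ := exists_separating_vector (τ := τ) ρ hirr hdist m hm
    (fun i l => (subrepIncl (X i)).comp ((φ i).symm.toIntertwiningMap.comp (tensorIncl _ _ l))) (by
      rw [eq_top_iff, ← hX.submodule_iSup_eq_top]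
      refine iSup_mono fun i x hx => ?_
      have h := sum_tensorIncl_tensorProj (ρ i) (m i) (φ i ⟨x, hx⟩)
      have h2 : ∑ l, ((φ i).symm (tensorIncl (ρ i) (m i) l
          (tensorProj (ρ i) (m i) l (φ i ⟨x, hx⟩))) : (X i).toSubmodule) = ⟨x, hx⟩ := by
        rw [← map_sum, h, Equiv.symm_apply_apply]
      have h3 := congrArg (X i).toSubmodule.subtype h2
      rw [map_sum] at h3
      change (X i).toSubmodule.subtype ⟨x, hx⟩ ∈ _
      rw [← h3]
      exact Submodule.sum_mem _ fun l _ => Submodule.mem_iSup_of_mem l ⟨_, rfl⟩)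
  refine ⟨v, fun f hf => ?_⟩
  apply IntertwiningMap.ext
  refine LinearMap.ext fun x => eq_zero_of_internalProj_eq_zero X hX fun j => ?_
  -- Each `U j`-coordinate of `f` is an intertwining map that kills `v`.
  have hc (l : Fin (m j)) :
      (tensorProj (ρ j) (m j) l).comp ((φ j).toIntertwiningMap.comp
        ((internalProj X hX j).comp f)) = 0 :=
    hv j _ (by simp [hf])
  have hz : φ j (internalProj X hX j (f x)) = 0 := by
    rw [← sum_tensorIncl_tensorProj (ρ j) (m j) (φ j (internalProj X hX j (f x)))]
    refine Finset.sum_eq_zero fun l _ => ?_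
    have h := DFunLike.congr_fun (hc l) x
    have h' : tensorProj (ρ j) (m j) l (φ j (internalProj X hX j (f x))) = 0 := h
    rw [h', map_zero]
  exact (φ j).toLinearEquiv.map_eq_zero_iff.1 hz

end Representation

end

noncomputable section

namespace OrbitEnergy

open Matrix

/-! ### Functional calculus of symmetric real matrices. -/

section Calculus

variable {n : Type*} [Fintype n] [DecidableEq n] {A : Matrix n n ℝ}

/-- Finiteness of the spectrum admits even `x⁻¹` to the continuous functional calculus. -/
theorem continuousOn_real_spectrum (A : Matrix n n ℝ) (f : ℝ → ℝ) :
    ContinuousOn f (spectrum ℝ A) :=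
  (Matrix.finite_real_spectrum (A := A)).continuousOn f

theorem nonneg_of_mem_spectrum (hA : A.PosSemidef) {x : ℝ}
    (hx : x ∈ spectrum ℝ A) : 0 ≤ x := by
  rw [hA.isHermitian.spectrum_real_eq_range_eigenvalues] at hx
  obtain ⟨i, rfl⟩ := hx
  exact hA.eigenvalues_nonneg i

theorem transpose_cfc (f : ℝ → ℝ) : (cfc f A)ᵀ = cfc f A := by
  have h : IsSelfAdjoint (cfc f A) := IsSelfAdjoint.cfc
  rw [← Matrix.conjTranspose_eq_transpose_of_trivial]
  exact h

theorem cfc_sqrt_mul_self (hA : A.PosSemidef) : cfc Real.sqrt A * cfc Real.sqrt A = A := by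
  have hs : IsSelfAdjoint A := hA.isHermitian
  rw [← cfc_mul _ _ A (continuousOn_real_spectrum A _) (continuousOn_real_spectrum A _)]
  conv_rhs => rw [← cfc_id' ℝ A]
  exact cfc_congr fun x hx => Real.mul_self_sqrt (nonneg_of_mem_spectrum hA hx)

/-- The orthogonal projection to the range of a symmetric matrix. -/
def rangeProj (A : Matrix n n ℝ) : Matrix n n ℝ := cfc (fun x : ℝ => x * x⁻¹) A

theorem rangeProj_eq_mul (hA : IsSelfAdjoint A) :
    rangeProj A = A * cfc (fun x : ℝ => x⁻¹) A := by
  rw [rangeProj, cfc_mul _ _ A (continuousOn_real_spectrum A _) (continuousOn_real_spectrum A _),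
    cfc_id' ℝ A]

/-- As `0⁻¹ = 0`, the function `x * x⁻¹` is the indicator of `x ≠ 0`. -/
theorem rangeProj_mul (hA : IsSelfAdjoint A) : rangeProj A * A = A := by
  have h : rangeProj A * cfc (fun x : ℝ => x) A = cfc (fun x : ℝ => x) A := by
    rw [rangeProj, ← cfc_mul _ _ A (continuousOn_real_spectrum A _)
      (continuousOn_real_spectrum A _)]
    exact cfc_congr fun x _ => mul_inv_mul_cancel x
  rwa [cfc_id' ℝ A] at h

theorem cfc_inv_sqrt_mul_mul (hA : A.PosSemidef) :
    cfc (fun x => (√x)⁻¹) A * A * cfc (fun x => (√x)⁻¹) A = rangeProj A := by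
  have hs : IsSelfAdjoint A := hA.isHermitian
  have h : cfc (fun x => (√x)⁻¹) A * cfc (fun x : ℝ => x) A * cfc (fun x => (√x)⁻¹) A =
      rangeProj A := by
    rw [rangeProj, ← cfc_mul _ _ A (continuousOn_real_spectrum A _)
      (continuousOn_real_spectrum A _), ← cfc_mul _ _ A (continuousOn_real_spectrum A _)
      (continuousOn_real_spectrum A _)]
    refine cfc_congr fun x hx => ?_
    have hx0 := nonneg_of_mem_spectrum hA hx
    have h2 : (√x)⁻¹ * (√x)⁻¹ = x⁻¹ := by rw [← mul_inv, Real.mul_self_sqrt hx0]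
    change (√x)⁻¹ * x * (√x)⁻¹ = x * x⁻¹
    rw [mul_comm _ x, mul_assoc, h2]
  rwa [cfc_id' ℝ A] at h

end Calculus

/-! ### Gram matrices of orbits. -/

section Gram

variable {V Γ : Type*} [Fintype V] [Group Γ] [Fintype Γ] (π : Representation ℝ Γ (V → ℝ))

/-- The sum of the rank one matrices `(g • x) (g • x)ᵀ`. -/
def orbitGram (x : V → ℝ) : Matrix V V ℝ := ∑ g, vecMulVec (π g x) (π g x)

theorem orbitGram_mulVec (x y : V → ℝ) :
    orbitGram π x *ᵥ y = ∑ g, (π g x ⬝ᵥ y) • π g x := by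
  simp only [orbitGram, Matrix.sum_mulVec, Matrix.vecMulVec_mulVec, op_smul_eq_smul]

theorem dotProduct_orbitGram_mulVec (x y : V → ℝ) :
    y ⬝ᵥ orbitGram π x *ᵥ y = ∑ g, (π g x ⬝ᵥ y) ^ 2 := by
  rw [orbitGram_mulVec, dotProduct_sum]
  refine Finset.sum_congr rfl fun g _ => ?_
  rw [dotProduct_smul, smul_eq_mul, dotProduct_comm y, sq]

theorem posSemidef_orbitGram (x : V → ℝ) : (orbitGram π x).PosSemidef :=
  Matrix.posSemidef_sum _ fun g _ => by
    simpa using Matrix.posSemidef_vecMulVec_self_star (π g x)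

theorem orbitGram_mulVec_mem (E : Submodule ℝ (V → ℝ)) (hE : ∀ g, ∀ x ∈ E, π g x ∈ E)
    {x : V → ℝ} (hx : x ∈ E) (y : V → ℝ) : orbitGram π x *ᵥ y ∈ E := by
  rw [orbitGram_mulVec]
  exact E.sum_mem fun g _ => E.smul_mem _ (hE g x hx)

variable (hπ : ∀ g x y, π g x ⬝ᵥ y = x ⬝ᵥ π g⁻¹ y)

include hπ in
theorem orbitGram_mulVec_comm (x : V → ℝ) (g : Γ) (y : V → ℝ) :
    orbitGram π x *ᵥ π g y = π g (orbitGram π x *ᵥ y) := by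
  simp only [orbitGram_mulVec, map_sum, map_smul]
  refine Fintype.sum_equiv (_root_.Equiv.mulLeft g⁻¹) _ _ fun h => ?_
  have h1 : π h x ⬝ᵥ π g y = π (g⁻¹ * h) x ⬝ᵥ y := by
    rw [map_mul, Module.End.mul_apply, hπ g⁻¹, inv_inv]
  rw [_root_.Equiv.coe_mulLeft, h1, ← Module.End.mul_apply, ← map_mul, mul_inv_cancel_left]

theorem commute_toMatrix' [DecidableEq V] {A : Matrix V V ℝ} {f : (V → ℝ) →ₗ[ℝ] (V → ℝ)} :
    Commute A (LinearMap.toMatrix' f) ↔ ∀ x, A *ᵥ f x = f (A *ᵥ x) := by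
  rw [commute_iff_eq, ← Matrix.toLin'.injective.eq_iff, LinearMap.ext_iff]
  simp [Matrix.toLin'_mul]

theorem orbitGram_map (T : Matrix V V ℝ) (hT : ∀ g x, T *ᵥ π g x = π g (T *ᵥ x)) (x : V → ℝ) :
    orbitGram π (T *ᵥ x) = T * orbitGram π x * Tᵀ := by
  simp only [orbitGram, Matrix.mul_sum, Matrix.sum_mul, ← hT, Matrix.mul_vecMulVec,
    Matrix.vecMulVec_mul, Matrix.vecMul_transpose]

include hπ in
/-- If `v` generates the invariant subspace `E`, in the sense that no nonzero equivariant operator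
on `E` kills `v`, then its Gram operator is injective on `E`. -/
theorem eq_zero_of_orbitGram_mulVec_eq_zero (E : Submodule ℝ (V → ℝ))
    (hE : ∀ g, ∀ x ∈ E, π g x ∈ E) {v : V → ℝ}
    (hv : ∀ A : Matrix V V ℝ, (∀ g x, A *ᵥ π g x = π g (A *ᵥ x)) → (∀ x ∈ E, A *ᵥ x ∈ E) →
      A *ᵥ v = 0 → ∀ x ∈ E, A *ᵥ x = 0) {w : V → ℝ} (hw : w ∈ E)
    (h : orbitGram π v *ᵥ w = 0) : w = 0 := by
  have hsq : ∑ g, (π g v ⬝ᵥ w) ^ 2 = 0 := by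
    rw [← dotProduct_orbitGram_mulVec, h, dotProduct_zero]
  have hg (g : Γ) : π g v ⬝ᵥ w = 0 := pow_eq_zero_iff two_ne_zero |>.1 <|
    (Finset.sum_eq_zero_iff_of_nonneg fun g _ => sq_nonneg _).1 hsq g (Finset.mem_univ g)
  -- Orthogonality of `w` to the orbit of `v` is symmetric in `v` and `w`, so the equivariant Gram
  -- operator of `w` kills `v`, hence all of `E`, hence `w`.
  have hwv : orbitGram π w *ᵥ v = 0 := by
    rw [orbitGram_mulVec]
    refine Finset.sum_eq_zero fun g _ => ?_
    rw [hπ, dotProduct_comm, hg, zero_smul]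
  have hww := hv _ (orbitGram_mulVec_comm π hπ w)
    (fun x _ => orbitGram_mulVec_mem π E hE hw x) hwv w hw
  have hsq' : ∑ g, (π g w ⬝ᵥ w) ^ 2 = 0 := by
    rw [← dotProduct_orbitGram_mulVec, hww, dotProduct_zero]
  have h1 := (Finset.sum_eq_zero_iff_of_nonneg fun g _ => sq_nonneg _).1 hsq' 1
    (Finset.mem_univ 1)
  rw [map_one, Module.End.one_apply, pow_eq_zero_iff two_ne_zero] at h1
  exact dotProduct_self_eq_zero.1 h1

include hπ in
/-- Every invariant positive semidefinite matrix with range in `E` is the Gram matrix of the orbit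
of a single vector of `E`. -/
theorem exists_orbitGram_eq [DecidableEq V] (E : Submodule ℝ (V → ℝ))
    (hE : ∀ g, ∀ x ∈ E, π g x ∈ E) {v : V → ℝ} (hvE : v ∈ E)
    (hv : ∀ A : Matrix V V ℝ, (∀ g x, A *ᵥ π g x = π g (A *ᵥ x)) → (∀ x ∈ E, A *ᵥ x ∈ E) →
      A *ᵥ v = 0 → ∀ x ∈ E, A *ᵥ x = 0)
    {S : Matrix V V ℝ} (hS : S.PosSemidef) (hSE : ∀ x, S *ᵥ x ∈ E)
    (hSπ : ∀ g x, S *ᵥ π g x = π g (S *ᵥ x)) : ∃ χ ∈ E, orbitGram π χ = S := by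
  set F := orbitGram π v with hFdef
  have hF : F.PosSemidef := posSemidef_orbitGram π v
  have hFs : IsSelfAdjoint F := hF.isHermitian
  have hFE (x : V → ℝ) : F *ᵥ x ∈ E := orbitGram_mulVec_mem π E hE hvE x
  set P := rangeProj F with hP
  have hPE (x : V → ℝ) : P *ᵥ x ∈ E := by
    rw [hP, rangeProj_eq_mul hFs, ← Matrix.mulVec_mulVec]
    exact hFE _
  -- `F` is injective on the finite-dimensional `E`, so `E` lies in the range of `F`, which `P`
  -- fixes.
  have hPfix : ∀ w ∈ E, P *ᵥ w = w := by
    intro w hw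
    let f : E →ₗ[ℝ] E := (Matrix.toLin' F).restrict (fun x _ => hFE x)
    have hf : Function.Injective f := by
      rw [← LinearMap.ker_eq_bot, LinearMap.ker_eq_bot']
      intro x hx
      exact Subtype.ext (eq_zero_of_orbitGram_mulVec_eq_zero π hπ E hE hv x.2
        (congrArg Subtype.val hx))
    obtain ⟨u, hu⟩ := LinearMap.surjective_of_injective hf ⟨w, hw⟩
    have hu' : F *ᵥ (u : V → ℝ) = w := congrArg Subtype.val hu
    rw [← hu', Matrix.mulVec_mulVec, rangeProj_mul hFs]
  set R := cfc Real.sqrt S with hR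
  have hRR : R * R = S := cfc_sqrt_mul_self hS
  have hRt : Rᵀ = R := transpose_cfc _
  have hPt : Pᵀ = P := transpose_cfc _
  have hPS : P * S = S := by
    apply Matrix.toLin'.injective
    refine LinearMap.ext fun x => ?_
    simp only [Matrix.toLin'_apply, ← Matrix.mulVec_mulVec]
    exact hPfix _ (hSE x)
  -- Expanding `(PR - R)(PR - R)ᵀ` leaves only `S = R²`, for which `PS = S` is known.
  have hPR : P * R = R := by
    have h : (P * R - R) * (P * R - R)ᴴ = 0 := by
      rw [Matrix.conjTranspose_eq_transpose_of_trivial, Matrix.transpose_sub,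
        Matrix.transpose_mul, hRt, hPt, sub_mul, mul_sub, mul_sub]
      have e1 : P * R * (R * P) = P * S * P := by rw [← hRR]; simp only [mul_assoc]
      have e2 : P * R * R = P * S := by rw [← hRR, mul_assoc]
      have e3 : R * (R * P) = S * P := by rw [← hRR, mul_assoc]
      rw [e1, e2, e3, hRR, hPS, sub_self]
    exact sub_eq_zero.1 (Matrix.self_mul_conjTranspose_eq_zero.1 h)
  set Q := cfc (fun x => (√x)⁻¹) F with hQ
  have hQt : Qᵀ = Q := transpose_cfc _
  -- Functions of `S` and of `F` commute with whatever commutes with `S` and `F`.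
  have hT (g : Γ) : Commute (R * Q) (LinearMap.toMatrix' (π g)) := by
    refine Commute.mul_left ?_ ?_
    · exact Commute.cfc_real (commute_toMatrix'.2 (hSπ g)) _
    · exact Commute.cfc_real (commute_toMatrix'.2 (orbitGram_mulVec_comm π hπ v g)) _
  refine ⟨(R * Q) *ᵥ v, ?_, ?_⟩
  · rw [← hPR, mul_assoc, ← Matrix.mulVec_mulVec]
    exact hPE _
  · rw [orbitGram_map π _ (fun g => commute_toMatrix'.1 (hT g)), Matrix.transpose_mul, hRt, hQt]
    have e : R * Q * F * (Q * R) = R * (Q * F * Q) * R := by simp only [mul_assoc]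
    rw [← hFdef, e, cfc_inv_sqrt_mul_mul hF, mul_assoc, ← hP, hPR, hRR]

end Gram

end OrbitEnergy

end

noncomputable section

/-! ### Orbit energies, the cone and the embeddings. -/

namespace OrbitEnergy

open Matrix

variable {V : Type*} {G : SimpleGraph V} {Ψ : Subgroup (G ≃g G)}

theorem permRep_apply (σ : Ψ) (f : V → ℝ) (u : V) :
    permRep G Ψ σ f u = f (((σ⁻¹ : Ψ) : G ≃g G) u) := rfl

theorem permRep_dotProduct [Fintype V] (σ : Ψ) (x y : V → ℝ) :
    permRep G Ψ σ x ⬝ᵥ y = x ⬝ᵥ permRep G Ψ σ⁻¹ y := by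
  refine Fintype.sum_equiv (((σ⁻¹ : Ψ) : G ≃g G).toEquiv) _ _ fun u => ?_
  have h : ((σ⁻¹⁻¹ : Ψ) : G ≃g G) (((σ⁻¹ : Ψ) : G ≃g G) u) = u :=
    RelIso.inv_apply_self ((σ⁻¹ : Ψ) : G ≃g G) u
  simp only [permRep_apply, RelIso.coe_fn_toEquiv, h]

theorem edgeEnergy_permRep (σ : Ψ) (f : V → ℝ) (e : G.edgeSet) :
    edgeEnergy (permRep G Ψ σ f) e = edgeEnergy f ((σ⁻¹ • e : G.edgeSet) : Sym2 V) := by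
  obtain ⟨e, he⟩ := e
  induction e
  rfl

theorem edgeEnergy_smul (c : ℝ) (f : V → ℝ) (e : Sym2 V) :
    edgeEnergy (c • f) e = c ^ 2 * edgeEnergy f e := by
  induction e with
  | _ u v =>
    change (c * f u - c * f v) ^ 2 = c ^ 2 * (f u - f v) ^ 2
    ring

/-- The value of a symmetric matrix `M` on `1_u - 1_v`, for an unordered pair `uv`. -/
def edgeForm (M : Matrix V V ℝ) : Sym2 V → ℝ :=
  Sym2.lift ⟨fun u v => M u u + M v v - M u v - M v u, fun u v => by ring⟩

theorem edgeForm_add (M N : Matrix V V ℝ) (e : Sym2 V) :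
    edgeForm (M + N) e = edgeForm M e + edgeForm N e := by
  induction e with
  | _ u v =>
    change (M u u + N u u) + (M v v + N v v) - (M u v + N u v) - (M v u + N v u) =
      (M u u + M v v - M u v - M v u) + (N u u + N v v - N u v - N v u)
    ring

variable [Fintype V]

omit [Fintype V] in
theorem edgeForm_orbitGram [Fintype Ψ] (f : V → ℝ) (e : Sym2 V) :
    edgeForm (orbitGram (permRep G Ψ) f) e = ∑ σ : Ψ, edgeEnergy (permRep G Ψ σ f) e := by
  induction e with
  | _ u v =>
    have h (a b : V) : orbitGram (permRep G Ψ) f a b =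
        ∑ σ : Ψ, permRep G Ψ σ f a * permRep G Ψ σ f b := by
      simp only [orbitGram, Matrix.sum_apply, Matrix.vecMulVec_apply]
    change orbitGram (permRep G Ψ) f u u + orbitGram (permRep G Ψ) f v v -
      orbitGram (permRep G Ψ) f u v - orbitGram (permRep G Ψ) f v u =
      ∑ σ : Ψ, (permRep G Ψ σ f u - permRep G Ψ σ f v) ^ 2
    simp only [h, ← Finset.sum_add_distrib, ← Finset.sum_sub_distrib]
    exact Finset.sum_congr rfl fun σ _ => by ring

omit [Fintype V] in
theorem mem_orbitEdges [Finite V] {i : EdgeOrbit G Ψ} {e : G.edgeSet} :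
    e ∈ orbitEdges G Ψ i ↔ (Quotient.mk _ e : EdgeOrbit G Ψ) = i := by
  simp [orbitEdges]

theorem card_orbitEdges_pos (i : EdgeOrbit G Ψ) : 0 < ((orbitEdges G Ψ i).card : ℝ) := by
  obtain ⟨e, he⟩ := Quotient.exists_rep i
  exact_mod_cast Finset.card_pos.2 ⟨e, mem_orbitEdges.2 he⟩

theorem orbitEnergy_permRep (σ : Ψ) (f : V → ℝ) :
    orbitEnergy G Ψ (permRep G Ψ σ f) = orbitEnergy G Ψ f := by
  funext i
  refine Finset.sum_equiv (MulAction.toPerm σ⁻¹) (fun e => ?_) fun e _ => edgeEnergy_permRep σ f e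
  rw [mem_orbitEdges, mem_orbitEdges]
  have h : (Quotient.mk _ (σ⁻¹ • e) : EdgeOrbit G Ψ) = Quotient.mk _ e :=
    Quotient.sound ⟨σ⁻¹, rfl⟩
  rw [MulAction.toPerm_apply, h]

theorem orbitEnergy_smul (c : ℝ) (f : V → ℝ) :
    orbitEnergy G Ψ (c • f) = c ^ 2 • orbitEnergy G Ψ f := by
  funext i
  simp only [orbitEnergy, edgeEnergy_smul, Pi.smul_apply, smul_eq_mul, Finset.mul_sum]

/-- The orbit-energy vector is a linear function of the Gram matrix of the orbit. -/
theorem card_mul_orbitEnergy [Fintype Ψ] (f : V → ℝ) (i : EdgeOrbit G Ψ) :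
    (Fintype.card Ψ : ℝ) * orbitEnergy G Ψ f i =
      ∑ e ∈ orbitEdges G Ψ i, edgeForm (orbitGram (permRep G Ψ) f) e := by
  simp only [edgeForm_orbitGram]
  rw [Finset.sum_comm]
  have h (σ : Ψ) : ∑ e ∈ orbitEdges G Ψ i, edgeEnergy (permRep G Ψ σ f) e =
      orbitEnergy G Ψ f i := congrFun (orbitEnergy_permRep σ f) i
  simp only [h, Finset.sum_const, Finset.card_univ, nsmul_eq_mul]

theorem orbitEnergy_eq_add [Fintype Ψ] {χ φ ψ : V → ℝ}
    (h : orbitGram (permRep G Ψ) χ = orbitGram (permRep G Ψ) φ + orbitGram (permRep G Ψ) ψ) :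
    orbitEnergy G Ψ χ = orbitEnergy G Ψ φ + orbitEnergy G Ψ ψ := by
  funext i
  have hc : (Fintype.card Ψ : ℝ) ≠ 0 := by exact_mod_cast Fintype.card_ne_zero
  apply mul_left_cancel₀ hc
  rw [Pi.add_apply, mul_add, card_mul_orbitEnergy, card_mul_orbitEnergy, card_mul_orbitEnergy, h]
  simp only [edgeForm_add, Finset.sum_add_distrib]

omit [Fintype V] in
theorem edgeSqLength_eq_sum {r : ℕ} (p : V → EuclideanSpace ℝ (Fin r)) (e : Sym2 V) :
    edgeSqLength p e = ∑ j, edgeEnergy (fun v => p v j) e := by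
  induction e with
  | _ u v =>
    change ‖p u - p v‖ ^ 2 = ∑ j, (p u j - p v j) ^ 2
    simp [EuclideanSpace.norm_sq_eq]

variable [DecidableEq V] [DecidableRel G.Adj]

/-- Without edges the Laplacian vanishes. An edge is needed to exclude `φ = 0` when `φ` is turned
into an embedding. -/
theorem exists_edge_of_hasEigenvalue {lam : ℝ} (hlam : lam ≠ 0)
    (h : (laplacian G).HasEigenvalue lam) : Nonempty G.edgeSet := by
  by_contra hne
  obtain ⟨f, hf⟩ := h.exists_hasEigenvector
  have hadj (u v : V) : ¬ G.Adj u v := fun huv => hne ⟨⟨s(u, v), huv⟩⟩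
  have h0 : laplacian G f = 0 := by
    funext u
    simp [laplacian_apply, hadj]
  have h1 := hf.apply_eq_smul
  rw [h0] at h1
  exact hf.2 ((smul_eq_zero.1 h1.symm).resolve_left hlam)

/-- If a vector of the eigenspace is killed by no nonzero equivariant operator, the orbit-energy
vectors of the eigenspace are closed under addition. -/
theorem exists_orbitEnergy_eq_add {lam : ℝ} (v : (laplacian G).eigenspace lam)
    (hv : ∀ f : (eigenRep G Ψ lam).IntertwiningMap (eigenRep G Ψ lam), f v = 0 → f = 0)
    {φ ψ : V → ℝ} (hφ : φ ∈ (laplacian G).eigenspace lam)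
    (hψ : ψ ∈ (laplacian G).eigenspace lam) :
    ∃ χ ∈ (laplacian G).eigenspace lam,
      orbitEnergy G Ψ χ = orbitEnergy G Ψ φ + orbitEnergy G Ψ ψ := by
  have : Finite (G ≃g G) := DFunLike.finite _
  have := Fintype.ofFinite Ψ
  have hE := (eigenSubrep G Ψ lam).apply_mem_toSubmodule
  have hinv := permRep_dotProduct (G := G) (Ψ := Ψ)
  obtain ⟨χ, hχ, hg⟩ := exists_orbitGram_eq (permRep G Ψ) hinv
    ((laplacian G).eigenspace lam) hE v.2 (by
      intro A hA hAE hAv x hx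
      let f : (eigenRep G Ψ lam).IntertwiningMap (eigenRep G Ψ lam) :=
        { toLinearMap := (Matrix.toLin' A).restrict hAE
          isIntertwining' := fun g => LinearMap.ext fun y => Subtype.ext (hA g y) }
      have hf : f = 0 := hv f (Subtype.ext hAv)
      exact congrArg Subtype.val (DFunLike.congr_fun hf ⟨x, hx⟩))
    ((posSemidef_orbitGram (permRep G Ψ) φ).add (posSemidef_orbitGram (permRep G Ψ) ψ))
    (fun x => by
      rw [Matrix.add_mulVec]
      exact Submodule.add_mem _ (orbitGram_mulVec_mem _ _ hE hφ x)
        (orbitGram_mulVec_mem _ _ hE hψ x))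
    (fun g x => by
      rw [Matrix.add_mulVec, Matrix.add_mulVec, map_add, orbitGram_mulVec_comm _ hinv,
        orbitGram_mulVec_comm _ hinv])
  exact ⟨χ, hχ, orbitEnergy_eq_add hg⟩

/-- The set of orbit-energy vectors of an eigenspace, as a cone, when it is closed under
addition. -/
def energyCone (G : SimpleGraph V) [DecidableRel G.Adj] (Ψ : Subgroup (G ≃g G)) (lam : ℝ)
    (hadd : ∀ φ ∈ (laplacian G).eigenspace lam, ∀ ψ ∈ (laplacian G).eigenspace lam,
      ∃ χ ∈ (laplacian G).eigenspace lam,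
        orbitEnergy G Ψ χ = orbitEnergy G Ψ φ + orbitEnergy G Ψ ψ) :
    PointedCone ℝ (EdgeOrbit G Ψ → ℝ) where
  carrier := orbitEnergy G Ψ '' ((laplacian G).eigenspace lam)
  zero_mem' := ⟨0, Submodule.zero_mem _, by
    rw [← zero_smul ℝ (0 : V → ℝ), orbitEnergy_smul]; simp⟩
  add_mem' := by
    rintro _ _ ⟨φ, hφ, rfl⟩ ⟨ψ, hψ, rfl⟩
    exact hadd φ hφ ψ hψ
  smul_mem' := by
    rintro c _ ⟨φ, hφ, rfl⟩
    -- The energy is quadratic in `φ`.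
    refine ⟨√(c : ℝ) • φ, Submodule.smul_mem _ _ hφ, ?_⟩
    rw [orbitEnergy_smul, Real.sq_sqrt c.2]
    rfl

theorem hasOrbitIsometricEmbedding_iff {lam : ℝ} (hedge : Nonempty G.edgeSet)
    (C : PointedCone ℝ (EdgeOrbit G Ψ → ℝ))
    (hC : (C : Set (EdgeOrbit G Ψ → ℝ)) =
      orbitEnergy G Ψ '' ((laplacian G).eigenspace lam)) :
    HasOrbitIsometricEmbedding G Ψ lam ↔
      ∃ φ ∈ (laplacian G).eigenspace lam, orbitEnergy G Ψ φ = orbitSizes G Ψ := by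
  constructor
  · rintro ⟨r, p, hp, c, hc, hpc⟩
    have hmem (j : Fin r) : orbitEnergy G Ψ (fun v => p v j) ∈ C := by
      rw [← SetLike.mem_coe, hC]
      exact ⟨_, (hp j).1, rfl⟩
    have hsum : orbitSizes G Ψ =
        (⟨c⁻¹, inv_nonneg.2 hc.le⟩ : {x : ℝ // 0 ≤ x}) •
          ∑ j, orbitEnergy G Ψ (fun v => p v j) := by
      funext i
      have hi := hpc i
      have hpos := card_orbitEdges_pos i
      simp only [edgeSqLength_eq_sum] at hi
      rw [Finset.sum_comm] at hi
      change ((orbitEdges G Ψ i).card : ℝ) =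
        c⁻¹ * (∑ j, orbitEnergy G Ψ (fun v => p v j)) i
      rw [Finset.sum_apply]
      change _ = c⁻¹ * ∑ j, ∑ e ∈ orbitEdges G Ψ i, edgeEnergy (fun v => p v j) e
      rw [eq_inv_mul_iff_mul_eq₀ hc.ne', ← hi, one_div, mul_comm, mul_inv_cancel_left₀ hpos.ne']
    have h := Submodule.smul_mem C (⟨c⁻¹, inv_nonneg.2 hc.le⟩ : {x : ℝ // 0 ≤ x})
      (Submodule.sum_mem C fun j (_ : j ∈ Finset.univ) => hmem j)
    rw [← hsum, ← SetLike.mem_coe, hC] at h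
    exact h
  · rintro ⟨φ, hφ, h⟩
    -- The vector `φ` itself is an embedding in the line, with `c = 1`.
    refine ⟨1, fun v => !₂[φ v], fun j => ⟨?_, ?_⟩, 1, one_pos, fun i => ?_⟩
    · simpa using hφ
    · intro h0
      have h0' : φ = 0 := by simpa using h0
      obtain ⟨e⟩ := hedge
      have he := congrFun h (Quotient.mk _ e)
      have hpos := card_orbitEdges_pos (Quotient.mk _ e : EdgeOrbit G Ψ)
      rw [h0', ← zero_smul ℝ (0 : V → ℝ), orbitEnergy_smul] at he
      change _ = ((orbitEdges G Ψ _).card : ℝ) at he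
      rw [← he] at hpos
      simp at hpos
    · have hi := congrFun h i
      have hpos := card_orbitEdges_pos i
      change ∑ e ∈ orbitEdges G Ψ i, edgeEnergy φ e = ((orbitEdges G Ψ i).card : ℝ) at hi
      simp only [edgeSqLength_eq_sum]
      simp [hi, hpos.ne']

end OrbitEnergy

end

theorem mainTheorem5 {V : Type*} [Fintype V] [DecidableEq V] (G : SimpleGraph V)
    [DecidableRel G.Adj] (Ψ : Subgroup (G ≃g G)) (lam : ℝ) (hlam : 0 < lam)
    (heig : (OrbitEnergy.laplacian G).HasEigenvalue lam)
    -- the isotypic decomposition of the eigenspace, `X i ≅ ℝ ^ (m i) ⊗ U i`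
    {h : ℕ} (X : Fin h → Subrepresentation (OrbitEnergy.eigenRep G Ψ lam))
    (hX : DirectSum.IsInternal fun i => (X i).toSubmodule)
    (U : Fin h → Type*) [∀ i, AddCommGroup (U i)] [∀ i, Module ℝ (U i)]
    (ρ : ∀ i, Representation ℝ Ψ (U i)) (hirr : ∀ i, (ρ i).IsIrreducible)
    (hdist : ∀ i j, i ≠ j → IsEmpty ((ρ i).Equiv (ρ j)))
    (m : Fin h → ℕ)
    (hiso : ∀ i, Nonempty ((X i).toRepresentation.Equiv
      ((Representation.trivial ℝ Ψ (Fin (m i) → ℝ)).tprod (ρ i))))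
    -- the multiplicity bound
    (hm : ∀ i, m i ≤ OrbitEnergy.endDim (ρ i)) :
    (∃ C : PointedCone ℝ (OrbitEnergy.EdgeOrbit G Ψ → ℝ),
      (C : Set (OrbitEnergy.EdgeOrbit G Ψ → ℝ)) =
        OrbitEnergy.orbitEnergy G Ψ '' ((OrbitEnergy.laplacian G).eigenspace lam)) ∧
    (OrbitEnergy.HasOrbitIsometricEmbedding G Ψ lam ↔
      ∃ φ ∈ (OrbitEnergy.laplacian G).eigenspace lam,
        OrbitEnergy.orbitEnergy G Ψ φ = OrbitEnergy.orbitSizes G Ψ) := by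
  obtain ⟨v, hv⟩ := Representation.exists_separating_vector_of_isotypic X hX ρ hirr hdist m hiso hm
  have hC : ∃ C : PointedCone ℝ (OrbitEnergy.EdgeOrbit G Ψ → ℝ),
      (C : Set (OrbitEnergy.EdgeOrbit G Ψ → ℝ)) =
        OrbitEnergy.orbitEnergy G Ψ '' ((OrbitEnergy.laplacian G).eigenspace lam) :=
    ⟨OrbitEnergy.energyCone G Ψ lam fun _ hφ _ hψ =>
      OrbitEnergy.exists_orbitEnergy_eq_add v hv hφ hψ, rfl⟩
  obtain ⟨C, hC⟩ := hC
  exact ⟨⟨C, hC⟩, OrbitEnergy.hasOrbitIsometricEmbedding_iff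
    (OrbitEnergy.exists_edge_of_hasEigenvalue hlam.ne' heig) C hC⟩
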